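/- Let $\Gamma$ be a metrized graph with a chosen vertex set $V(\Gamma)$ having $v$ elements and edge set $E(\Gamma)=\{e_i\}$, that is, a finite connected graph, possibly with self-loops and multiple edges, whose edges $e_i$ have lengths $L_i>0$. View $\Gamma$ as an electric circuit in which the resistance of each edge is its length. Let $j_z(x,y)$ be the voltage at $x$, with reference voltage $0$ at $z$, when unit current enters at $y$ and exits at $z$; let $r(x,y)=j_y(x,x)$ be the effective resistance, and write $r_\beta$ for that of a graph $\beta$. Let $Kf(\Gamma)=\frac12\sum_{p,q\in V(\Gamma)}r(p,q)$ be the Kirchhoff index. For an edge $e_i$ with end points $p_i,q_i$, let $\Gamma-e_i$ be the graph obtained by deleting the interior of $e_i$, and let $\overline{\Gamma}_i$ be the graph obtained by contracting $e_i$, where $\overline{p}_i\in V(\overline{\Gamma}_i)$ denotes the vertex into which $e_i$ is contracted. If $\Gamma-e_i$ is connected, let $R_i$ be the resistance between $p_i$ and $q_i$ in $\Gamma-e_i$ and, for a vertex $p$, put $R_{a_i,p}=\hat{\jmath}_{p_i}(p,q_i)$ and $R_{b_i,p}=\hat{\jmath}_{q_i}(p,p_i)$, where $\hat{\jmath}$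 is the voltage function of $\Gamma-e_i$. If $\Gamma-e_i$ is not connected, put $R_{a_i,p}=0$, $R_{b_i,p}=R_i$ when $p$ lies in the component of $p_i$ in $\Gamma-e_i$, and $R_{a_i,p}=R_i$, $R_{b_i,p}=0$ when $p$ lies in the component of $q_i$; every expression containing $R_i$ then means its limit as $R_i\to\infty$. For a vertex $p$ of $\Gamma$ let $$y(\Gamma)=\frac14\sum_{e_i\in E(\Gamma)}\frac{L_iR_i^2}{(L_i+R_i)^2}+\frac34\sum_{e_i\in E(\Gamma)}\frac{L_i(R_{a_i,p}-R_{b_i,p})^2}{(L_i+R_i)^2}.$$ Then, whichever vertex $p$ is used to compute $y(\Gamma)$, $$2\,Kf(\Gamma)=v\cdot y(\Gamma)+\sum_{e_i\in E(\Gamma)}\frac{R_i}{L_i+R_i}\sum_{p\in V(\overline{\Gamma}_i)}r_{\overline{\Gamma}_i}(p,\overline{p}_i).$$ -/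

import Mathlib

open Filter

/-- A finite multigraph with vertex set `V` and edge set `E` (self-loops and multiple edges are
allowed), each edge being a segment of positive length parametrized from `src e` to `tgt e`.
A metrized graph with a chosen vertex set is such a graph which is moreover connected
(`LengthGraph.Connected` below); deleting an edge may lose connectedness, so it is a predicate. -/
structure LengthGraph (V E : Type*) where
  src : E → V
  tgt : E → V
  len : E → ℝ
  len_pos : ∀ e, 0 < len e

namespace LengthGraph

variable {V E : Type*}

/-- The simple graph joining distinct vertices that are the end points of a common edge. -/
def toSimpleGraph (Γ : LengthGraph V E) : SimpleGraph V :=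
  SimpleGraph.fromRel (fun a b => ∃ e, Γ.src e = a ∧ Γ.tgt e = b)

/-- `Γ` is connected (and has at least one vertex). -/
def Connected (Γ : LengthGraph V E) : Prop := Γ.toSimpleGraph.Connected

/-- `a` and `b` lie in the same connected component of `Γ`. -/
def SameComponent (Γ : LengthGraph V E) (a b : V) : Prop := Γ.toSimpleGraph.Reachable a b

/-- `Γ - e`: the interior of the edge `e` is deleted, all vertices are kept. -/
def delete (Γ : LengthGraph V E) (e : E) : LengthGraph V {e' : E // e' ≠ e} where
  src e' := Γ.src e'
  tgt e' := Γ.tgt e'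
  len e' := Γ.len e'
  len_pos e' := Γ.len_pos e'

/-- The vertices of the contraction of `e`: the end points of `e` are identified. -/
def ContractVertex (Γ : LengthGraph V E) (e : E) : Type _ :=
  Quot (fun a b : V => a = Γ.src e ∧ b = Γ.tgt e)

/-- The vertex of the contraction into which the vertex `p` is contracted. -/
def toContract (Γ : LengthGraph V E) (e : E) (p : V) : Γ.ContractVertex e := Quot.mk _ p

instance (Γ : LengthGraph V E) (e : E) [Finite V] : Finite (Γ.ContractVertex e) :=
  Finite.of_surjective (Γ.toContract e) Quot.mk_surjective

noncomputable instance (Γ : LengthGraph V E) (e : E) [Finite V] : Fintype (Γ.ContractVertex e) :=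
  Fintype.ofFinite _

/-- The graph obtained from `Γ` by contracting the edge `e` to its end points. -/
def contract (Γ : LengthGraph V E) (e : E) :
    LengthGraph (Γ.ContractVertex e) {e' : E // e' ≠ e} where
  src e' := Γ.toContract e (Γ.src e')
  tgt e' := Γ.toContract e (Γ.tgt e')
  len e' := Γ.len e'
  len_pos e' := Γ.len_pos e'

theorem contract_connected (Γ : LengthGraph V E) (e : E) (hΓ : Γ.Connected) :
    (Γ.contract e).Connected := by
  have hw : ∀ a b, Γ.SameComponent a b →
      (Γ.contract e).SameComponent (Γ.toContract e a) (Γ.toContract e b) := by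
    rintro a b ⟨w⟩
    induction w with
    | nil => exact SimpleGraph.Reachable.refl _
    | @cons u w v h _ ih =>
      refine SimpleGraph.Reachable.trans ?_ ih
      by_cases hc : Γ.toContract e u = Γ.toContract e w
      · rw [hc]
      · refine SimpleGraph.Adj.reachable ?_
        rw [toSimpleGraph, SimpleGraph.fromRel_adj] at h ⊢
        refine ⟨hc, ?_⟩
        have hne : Γ.toContract e (Γ.src e) = Γ.toContract e (Γ.tgt e) :=
          Quot.sound ⟨rfl, rfl⟩
        obtain ⟨-, ⟨e', rfl, rfl⟩ | ⟨e', rfl, rfl⟩⟩ := h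
        · exact Or.inl ⟨⟨e', fun h => hc (by rw [h, hne])⟩, rfl, rfl⟩
        · exact Or.inr ⟨⟨e', fun h => hc (by rw [h, hne])⟩, rfl, rfl⟩
  have : Nonempty (Γ.ContractVertex e) := hΓ.nonempty.map (Γ.toContract e)
  refine SimpleGraph.Connected.mk fun p q => ?_
  obtain ⟨a, rfl⟩ := Quot.mk_surjective p
  obtain ⟨b, rfl⟩ := Quot.mk_surjective q
  exact hw a b (hΓ.preconnected a b)

section Circuit

variable [Fintype E]

open Classical in
/-- The total current that leaves the vertex `x` along the edges, when the vertices have the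
potentials `f` and every edge has resistance equal to its length (Ohm's law). -/
noncomputable def outflow (Γ : LengthGraph V E) (f : V → ℝ) (x : V) : ℝ :=
  ∑ e, ((if Γ.src e = x then (f (Γ.src e) - f (Γ.tgt e)) / Γ.len e else 0) +
    (if Γ.tgt e = x then (f (Γ.tgt e) - f (Γ.src e)) / Γ.len e else 0))

open Classical in
/-- `f` is the potential, with reference value `0` at `z`, when unit current enters at `y` and
exits at `z` (Kirchhoff's current law at every vertex). -/
def IsVoltage (Γ : LengthGraph V E) (z y : V) (f : V → ℝ) : Prop :=
  f z = 0 ∧ ∀ x, Γ.outflow f x = (if x = y then 1 else 0) - (if x = z then 1 else 0)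

open Classical in
/-- The voltage function `j_z(x, y)`. On a connected finite graph the potential exists and is
unique (`existsUnique_isVoltage`); the value `0` otherwise is never used. -/
noncomputable def voltage (Γ : LengthGraph V E) (z x y : V) : ℝ :=
  if h : ∃ f, Γ.IsVoltage z y f then h.choose x else 0

/-- The effective resistance `r(x, y) = j_y(x, x)`. -/
noncomputable def resistance (Γ : LengthGraph V E) (x y : V) : ℝ := Γ.voltage y x x

theorem sum_mul_outflow [Fintype V] (Γ : LengthGraph V E) (f g : V → ℝ) :
    ∑ x, g x * Γ.outflow f x =
      ∑ e, (g (Γ.src e) - g (Γ.tgt e)) * (f (Γ.src e) - f (Γ.tgt e)) / Γ.len e := by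
  classical
  simp only [outflow, Finset.mul_sum]
  rw [Finset.sum_comm]
  refine Finset.sum_congr rfl fun e _ => ?_
  simp only [mul_add, Finset.sum_add_distrib, mul_ite, mul_zero, Finset.sum_ite_eq,
    Finset.mem_univ, if_true]
  ring

theorem outflow_sub (Γ : LengthGraph V E) (f g : V → ℝ) (x : V) :
    Γ.outflow (f - g) x = Γ.outflow f x - Γ.outflow g x := by
  simp only [outflow, ← Finset.sum_sub_distrib]
  refine Finset.sum_congr rfl fun e _ => ?_
  simp only [Pi.sub_apply]
  split_ifs <;> ring

theorem outflow_add (Γ : LengthGraph V E) (f g : V → ℝ) (x : V) :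
    Γ.outflow (f + g) x = Γ.outflow f x + Γ.outflow g x := by
  simp only [outflow, ← Finset.sum_add_distrib]
  refine Finset.sum_congr rfl fun e _ => ?_
  simp only [Pi.add_apply]
  split_ifs <;> ring

theorem outflow_smul (Γ : LengthGraph V E) (c : ℝ) (f : V → ℝ) (x : V) :
    Γ.outflow (c • f) x = c * Γ.outflow f x := by
  simp only [outflow, Finset.mul_sum]
  refine Finset.sum_congr rfl fun e _ => ?_
  simp only [Pi.smul_apply, smul_eq_mul]
  split_ifs <;> ring

theorem eq_zero_of_outflow [Fintype V] (Γ : LengthGraph V E) (hΓ : Γ.Connected) (z : V)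
    (f : V → ℝ) (hz : f z = 0) (hf : ∀ x, x ≠ z → Γ.outflow f x = 0) : f = 0 := by
  classical
  have h0 : ∑ x, f x * Γ.outflow f x = 0 := by
    refine Finset.sum_eq_zero fun x _ => ?_
    by_cases h : x = z
    · rw [h, hz, zero_mul]
    · rw [hf x h, mul_zero]
  rw [sum_mul_outflow] at h0
  have hnn : ∀ e ∈ Finset.univ,
      0 ≤ (f (Γ.src e) - f (Γ.tgt e)) * (f (Γ.src e) - f (Γ.tgt e)) / Γ.len e :=
    fun e _ => div_nonneg (mul_self_nonneg _) (Γ.len_pos e).le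
  have hedge : ∀ e, f (Γ.src e) = f (Γ.tgt e) := by
    intro e
    have h1 := (Finset.sum_eq_zero_iff_of_nonneg hnn).1 h0 e (Finset.mem_univ e)
    rcases div_eq_zero_iff.1 h1 with h2 | h2
    · exact sub_eq_zero.1 (mul_self_eq_zero.1 h2)
    · exact absurd h2 (Γ.len_pos e).ne'
  have hwalk : ∀ a b (_ : Γ.toSimpleGraph.Walk a b), f a = f b := by
    intro a b w
    induction w with
    | nil => rfl
    | cons h _ ih =>
      rw [← ih]
      rw [toSimpleGraph, SimpleGraph.fromRel_adj] at h
      obtain ⟨-, ⟨e, rfl, rfl⟩ | ⟨e, rfl, rfl⟩⟩ := h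
      · exact hedge e
      · exact (hedge e).symm
  funext x
  obtain ⟨w⟩ := hΓ.preconnected x z
  rw [hwalk x z w, hz, Pi.zero_apply]

/-- On a finite connected graph the voltage function is well defined. -/
theorem existsUnique_isVoltage [Fintype V] (Γ : LengthGraph V E) (hΓ : Γ.Connected) (z y : V) :
    ∃! f, Γ.IsVoltage z y f := by
  classical
  let T : (V → ℝ) →ₗ[ℝ] (V → ℝ) :=
    { toFun := fun f x => if x = z then f z else Γ.outflow f x
      map_add' := fun f g => by
        funext x
        simp only [outflow_add, Pi.add_apply]
        split_ifs <;> rfl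
      map_smul' := fun c f => by
        funext x
        simp only [outflow_smul, Pi.smul_apply, smul_eq_mul, RingHom.id_apply]
        split_ifs <;> rfl }
  have hinj : Function.Injective T := by
    refine (injective_iff_map_eq_zero T).2 fun f hf => ?_
    refine Γ.eq_zero_of_outflow hΓ z f ?_ fun x hx => ?_
    · have := congrFun hf z
      simpa [T] using this
    · have := congrFun hf x
      simpa [T, hx] using this
  obtain ⟨f, hf⟩ := LinearMap.surjective_of_injective hinj
    (fun x => if x = z then 0 else if x = y then 1 else 0)
  have hz : f z = 0 := by simpa [T] using congrFun hf z
  have hx : ∀ x, x ≠ z → Γ.outflow f x = if x = y then 1 else 0 := fun x hx => by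
    simpa [T, hx] using congrFun hf x
  refine ⟨f, ⟨hz, ?_⟩, ?_⟩
  · have hsum := Γ.sum_mul_outflow f (fun _ => 1)
    simp only [one_mul, sub_self, zero_mul, zero_div, Finset.sum_const_zero] at hsum
    rw [← Finset.add_sum_erase _ _ (Finset.mem_univ z),
      Finset.sum_congr rfl (fun x h => hx x (Finset.ne_of_mem_erase h)), Finset.sum_ite_eq'] at hsum
    intro x
    by_cases h : x = z
    · subst h
      by_cases hy : x = y
      · subst hy
        simpa using hsum
      · have : y ≠ x := fun h => hy h.symm
        simp [this] at hsum
        simp [hy]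
        linarith
    · rw [hx x h]
      simp [h]
  · rintro g ⟨gz, gx⟩
    refine sub_eq_zero.1 (Γ.eq_zero_of_outflow hΓ z (g - f) (by simp [gz, hz]) fun x h => ?_)
    rw [outflow_sub, gx, hx x h]
    simp [h]

/-- The Kirchhoff index. -/
noncomputable def kirchhoffIndex [Fintype V] (Γ : LengthGraph V E) : ℝ :=
  1 / 2 * ∑ p, ∑ q, Γ.resistance p q

open Classical in
/-- The resistance `R_e` between the end points of `e` in `Γ - e`, used when `Γ - e` is
connected. -/
noncomputable def deletedResistance (Γ : LengthGraph V E) (e : E) : ℝ :=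
  (Γ.delete e).resistance (Γ.src e) (Γ.tgt e)

open Classical in
/-- The value at `R = R_e` of an expression `F R`; if `e` is a bridge, then `R_e = ∞` and the value
is the limit of `F R` as `R → ∞`. -/
noncomputable def evalR (Γ : LengthGraph V E) (e : E) (F : ℝ → ℝ) : ℝ :=
  if (Γ.delete e).Connected then F (Γ.deletedResistance e) else limUnder atTop F

open Classical in
/-- `R_{a_e, p}`, as a function of `R = R_e`. If `Γ - e` is connected, it is the voltage
`j_{src e}(p, tgt e)` in `Γ - e`. Otherwise it is `0` if `p` is in the component of `src e` in
`Γ - e`, and `R` if `p` is in the component of `tgt e`. -/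
noncomputable def Ra (Γ : LengthGraph V E) (e : E) (p : V) (R : ℝ) : ℝ :=
  if (Γ.delete e).Connected then (Γ.delete e).voltage (Γ.src e) p (Γ.tgt e)
  else if (Γ.delete e).SameComponent p (Γ.src e) then 0 else R

open Classical in
/-- `R_{b_e, p}`, as a function of `R = R_e`; as `Ra`, with the end points of `e` exchanged. -/
noncomputable def Rb (Γ : LengthGraph V E) (e : E) (p : V) (R : ℝ) : ℝ :=
  if (Γ.delete e).Connected then (Γ.delete e).voltage (Γ.tgt e) p (Γ.src e)
  else if (Γ.delete e).SameComponent p (Γ.src e) then R else 0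

theorem tendsto_ratio (L : ℝ) : Tendsto (fun R : ℝ => R / (L + R)) atTop (nhds 1) := by
  have h1 : Tendsto (fun R : ℝ => 1 - L / (L + R)) atTop (nhds (1 - 0)) :=
    tendsto_const_nhds.sub (tendsto_const_nhds.div_atTop (tendsto_atTop_add_const_left _ L tendsto_id))
  rw [sub_zero] at h1
  refine h1.congr' ?_
  filter_upwards [eventually_gt_atTop (-L)] with R hR
  have : L + R ≠ 0 := by linarith
  field_simp
  ring

/-- The coefficient `R_e / (L_e + R_e)` of a bridge is `1`. -/
theorem evalR_ratio_of_bridge (Γ : LengthGraph V E) (e : E) (h : ¬ (Γ.delete e).Connected) :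
    Γ.evalR e (fun R => R / (Γ.len e + R)) = 1 := by
  rw [evalR, if_neg h]
  exact (tendsto_ratio _).limUnder_eq

theorem evalR_sq_of_bridge (Γ : LengthGraph V E) (e : E) (h : ¬ (Γ.delete e).Connected) :
    Γ.evalR e (fun R => Γ.len e * R ^ 2 / (Γ.len e + R) ^ 2) = Γ.len e := by
  rw [evalR, if_neg h]
  have := ((tendsto_ratio (Γ.len e)).pow 2).const_mul (Γ.len e)
  simp only [one_pow, mul_one, div_pow, ← mul_div_assoc] at this
  exact this.limUnder_eq

theorem evalR_sub_sq_of_bridge (Γ : LengthGraph V E) (e : E) (p : V)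
    (h : ¬ (Γ.delete e).Connected) :
    Γ.evalR e (fun R => Γ.len e * (Γ.Ra e p R - Γ.Rb e p R) ^ 2 / (Γ.len e + R) ^ 2) =
      Γ.len e := by
  refine Eq.trans ?_ (evalR_sq_of_bridge Γ e h)
  congr 1
  funext R
  simp only [Ra, Rb, if_neg h]
  split_ifs <;> simp

/-- The invariant `y(Γ)`, computed from the vertex `p`. -/
noncomputable def y (Γ : LengthGraph V E) (p : V) : ℝ :=
  1 / 4 * ∑ e, Γ.evalR e (fun R => Γ.len e * R ^ 2 / (Γ.len e + R) ^ 2) +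
  3 / 4 * ∑ e, Γ.evalR e
    (fun R => Γ.len e * (Γ.Ra e p R - Γ.Rb e p R) ^ 2 / (Γ.len e + R) ^ 2)

open Classical in
/-- The sum, over the vertices `p` of the contraction of `e`, of the resistance in that
contraction between `p` and the vertex into which `e` is contracted. -/
noncomputable def contractResistanceSum [Fintype V] (Γ : LengthGraph V E) (e : E) : ℝ :=
  ∑ p : Γ.ContractVertex e, (Γ.contract e).resistance p (Γ.toContract e (Γ.src e))

end Circuit

end LengthGraph

/-! Everything is rewritten through resistances of Γ itself. Put r_e for the resistance in Γ between
the ends s, t of e, and a = r(s, p), b = r(t, p). The parallel law r_e = L R / (L + R), or r_e = L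
for a bridge, turns y(Γ) into (1/4) Σ r_e²/L + (3/4) D(p), where D(p) = Σ (a - b)²/L is the
Dirichlet energy of r(·, p) (`y_eq`). Grounding both ends of e turns the weighted contraction sum
into Σ_p (2 r_e (a + b) - (a - b)² - r_e²) / (4L) (`evalR_ratio_mul_contractResistanceSum`).

The engine is `outflow_resistance`: the Laplacian of r(·, p) is 2 - 2δ_p minus a function
independent of p. Symmetry of the Laplacian then makes D(p) independent of p
(`resistanceEnergy_eq`), and pairing r(·, p) with its own Laplacian gives 2 Σ_x r(x, p) = Σ_e r_e (a
+ b)/L + D(p) (`sum_resistance_eq`). For each fixed p the r_e² terms cancel and 3/4 - 1/4 = 1/2 of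
D(p) is left, which is half of this identity; summing over p gives the theorem. -/

namespace LengthGraph

/-! ### Voltages, resistances and the Laplacian of r(·, p). -/

section Potential

variable {V E : Type*} [Fintype V] [Fintype E] {Γ : LengthGraph V E}

theorem isVoltage_voltage (hΓ : Γ.Connected) (z y : V) :
    Γ.IsVoltage z y (fun x => Γ.voltage z x y) := by
  have h := (Γ.existsUnique_isVoltage hΓ z y).exists
  have : (fun x => Γ.voltage z x y) = h.choose := by
    funext x
    rw [voltage, dif_pos h]
  rw [this]
  exact h.choose_spec

theorem IsVoltage.voltage_eq (hΓ : Γ.Connected) {z y : V} {f : V → ℝ} (hf : Γ.IsVoltage z y f)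
    (x : V) : Γ.voltage z x y = f x :=
  congrFun ((Γ.existsUnique_isVoltage hΓ z y).unique (isVoltage_voltage hΓ z y) hf) x

theorem voltage_self_left (hΓ : Γ.Connected) (z y : V) : Γ.voltage z z y = 0 :=
  (isVoltage_voltage hΓ z y).1

open Classical in
theorem outflow_voltage (hΓ : Γ.Connected) (z y x : V) :
    Γ.outflow (fun w => Γ.voltage z w y) x =
      (if x = y then 1 else 0) - (if x = z then 1 else 0) :=
  (isVoltage_voltage hΓ z y).2 x

theorem sum_mul_outflow_comm (Γ : LengthGraph V E) (f g : V → ℝ) :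
    ∑ x, g x * Γ.outflow f x = ∑ x, f x * Γ.outflow g x := by
  rw [sum_mul_outflow, sum_mul_outflow]
  exact Finset.sum_congr rfl fun e _ => by ring

theorem sum_mul_outflow_voltage (hΓ : Γ.Connected) (z y : V) (g : V → ℝ) :
    ∑ x, g x * Γ.outflow (fun w => Γ.voltage z w y) x = g y - g z := by
  classical
  simp [outflow_voltage hΓ, mul_sub, Finset.sum_sub_distrib]

theorem voltage_comm (hΓ : Γ.Connected) (z x y : V) : Γ.voltage z x y = Γ.voltage z y x := by
  have h := sum_mul_outflow_comm Γ (fun w => Γ.voltage z w y) (fun w => Γ.voltage z w x)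
  rw [sum_mul_outflow_voltage hΓ, sum_mul_outflow_voltage hΓ, voltage_self_left hΓ,
    voltage_self_left hΓ, sub_zero, sub_zero] at h
  exact h.symm

theorem outflow_const {V E : Type*} [Fintype E] (Γ : LengthGraph V E) (c : ℝ) (x : V) : Γ.outflow (fun _ => c) x = 0 := by
  simp [outflow]

/-- Superposition: subtracting the flows from x to z and from y to z leaves the flow from x to y, up
to a constant fixed by the value at y. -/
theorem voltage_change_base (hΓ : Γ.Connected) (z x y w : V) :
    Γ.voltage y w x =
      Γ.voltage z w x - Γ.voltage z w y - (Γ.voltage z y x - Γ.voltage z y y) := by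
  refine IsVoltage.voltage_eq hΓ (f := fun w =>
    Γ.voltage z w x - Γ.voltage z w y - (Γ.voltage z y x - Γ.voltage z y y)) ⟨by ring, ?_⟩ w
  intro v
  have h : Γ.outflow _ v = _ := outflow_sub Γ ((fun w => Γ.voltage z w x) - fun w => Γ.voltage z w y)
    (fun _ => Γ.voltage z y x - Γ.voltage z y y) v
  have h' := outflow_sub Γ (fun w => Γ.voltage z w x) (fun w => Γ.voltage z w y) v
  rw [outflow_const, h', outflow_voltage hΓ, outflow_voltage hΓ] at h
  refine h.trans ?_
  ring

theorem resistance_eq (hΓ : Γ.Connected) (z x y : V) :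
    Γ.resistance x y = Γ.resistance x z + Γ.resistance y z - 2 * Γ.voltage z x y := by
  rw [resistance, voltage_change_base hΓ z, voltage_comm hΓ z y x, resistance, resistance]
  ring

theorem resistance_self (hΓ : Γ.Connected) (x : V) : Γ.resistance x x = 0 :=
  voltage_self_left hΓ x x

theorem resistance_comm (hΓ : Γ.Connected) (x y : V) : Γ.resistance x y = Γ.resistance y x := by
  rw [resistance_eq hΓ x x y, resistance_self hΓ, voltage_self_left hΓ]
  ring

theorem voltage_swap (hΓ : Γ.Connected) (x y p : V) :
    Γ.voltage y p x = Γ.resistance x y - Γ.voltage x p y := by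
  rw [voltage_change_base hΓ x, voltage_comm hΓ x p x, voltage_comm hΓ x y x,
    voltage_self_left hΓ, voltage_self_left hΓ, resistance_comm hΓ, resistance]
  ring

theorem resistance_nonneg (hΓ : Γ.Connected) (x y : V) : 0 ≤ Γ.resistance x y := by
  have h := sum_mul_outflow_voltage hΓ y x (fun w => Γ.voltage y w x)
  rw [sum_mul_outflow, voltage_self_left hΓ, sub_zero] at h
  rw [resistance, ← h]
  exact Finset.sum_nonneg fun e _ => div_nonneg (mul_self_nonneg _) (Γ.len_pos e).le

/-- The resistance is the energy of the unit flow; if it vanishes, no edge carries current, so no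
current can enter at x. -/
theorem eq_of_resistance_eq_zero (hΓ : Γ.Connected) {x y : V} (h : Γ.resistance x y = 0) :
    x = y := by
  classical
  by_contra hxy
  have h0 := sum_mul_outflow_voltage hΓ y x (fun w => Γ.voltage y w x)
  rw [sum_mul_outflow, voltage_self_left hΓ, sub_zero, ← resistance, h,
    Finset.sum_eq_zero_iff_of_nonneg fun e _ =>
      div_nonneg (mul_self_nonneg _) (Γ.len_pos e).le] at h0
  have hedge : ∀ e, Γ.voltage y (Γ.src e) x = Γ.voltage y (Γ.tgt e) x := fun e => by
    simpa [(Γ.len_pos e).ne', sub_eq_zero] using h0 e (Finset.mem_univ e)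
  have h1 := outflow_voltage hΓ y x x
  simp [outflow, hedge, hxy] at h1

/-- The resistance between the end points of an edge. -/
noncomputable def edgeResistance (Γ : LengthGraph V E) (e : E) : ℝ :=
  Γ.resistance (Γ.src e) (Γ.tgt e)

open Classical in
/-- The sum of `r(e) / L(e)` over the edge ends at `x`. -/
noncomputable def fosterSum (Γ : LengthGraph V E) (x : V) : ℝ :=
  ∑ e, ((if Γ.src e = x then Γ.edgeResistance e / Γ.len e else 0) +
    (if Γ.tgt e = x then Γ.edgeResistance e / Γ.len e else 0))

theorem sum_mul_fosterSum (Γ : LengthGraph V E) (f : V → ℝ) :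
    ∑ x, f x * Γ.fosterSum x =
      ∑ e, Γ.edgeResistance e * (f (Γ.src e) + f (Γ.tgt e)) / Γ.len e := by
  classical
  simp only [fosterSum, Finset.mul_sum]
  rw [Finset.sum_comm]
  refine Finset.sum_congr rfl fun e _ => ?_
  simp only [mul_add, Finset.sum_add_distrib, mul_ite, mul_zero, Finset.sum_ite_eq,
    Finset.mem_univ, if_true]
  ring

-- On an edge from x to x', r(x, p) - r(x', p) + r_e is twice the drop of j_p(·, x). Hence adding
-- the Foster sum gives twice the outflow at x of the unit flow from x to p, which is 2 - 2δ_p.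
open Classical in
theorem outflow_resistance (hΓ : Γ.Connected) (p x : V) :
    Γ.outflow (fun w => Γ.resistance w p) x =
      2 - 2 * (if x = p then 1 else 0) - Γ.fosterSum x := by
  have h := outflow_voltage hΓ p x x
  rw [if_pos rfl] at h
  rw [← mul_one_sub, ← h, eq_sub_iff_add_eq, outflow, fosterSum, outflow, Finset.mul_sum,
    ← Finset.sum_add_distrib]
  refine Finset.sum_congr rfl fun e _ => ?_
  have key : Γ.edgeResistance e = Γ.resistance (Γ.src e) p + Γ.resistance (Γ.tgt e) p -
    2 * Γ.voltage p (Γ.src e) (Γ.tgt e) := resistance_eq hΓ p _ _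
  have hc := voltage_comm hΓ p (Γ.src e) (Γ.tgt e)
  have h1 : Γ.src e = x → (Γ.resistance (Γ.src e) p - Γ.resistance (Γ.tgt e) p) / Γ.len e +
      Γ.edgeResistance e / Γ.len e =
      2 * ((Γ.voltage p (Γ.src e) x - Γ.voltage p (Γ.tgt e) x) / Γ.len e) := by
    rintro rfl
    rw [key, hc, resistance, resistance]
    ring
  have h2 : Γ.tgt e = x → (Γ.resistance (Γ.tgt e) p - Γ.resistance (Γ.src e) p) / Γ.len e +
      Γ.edgeResistance e / Γ.len e =
      2 * ((Γ.voltage p (Γ.tgt e) x - Γ.voltage p (Γ.src e) x) / Γ.len e) := by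
    rintro rfl
    rw [key, resistance, resistance]
    ring
  split_ifs with hs ht ht
  · linarith [h1 hs, h2 ht]
  · linarith [h1 hs]
  · linarith [h2 ht]
  · ring

/-- The energy of the potential `r(·, p)`. -/
noncomputable def resistanceEnergy (Γ : LengthGraph V E) (p : V) : ℝ :=
  ∑ e, (Γ.resistance (Γ.src e) p - Γ.resistance (Γ.tgt e) p) ^ 2 / Γ.len e

theorem resistanceEnergy_eq_sum_mul_outflow (Γ : LengthGraph V E) (p : V) :
    Γ.resistanceEnergy p =
      ∑ x, Γ.resistance x p * Γ.outflow (fun w => Γ.resistance w p) x := by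
  rw [sum_mul_outflow, resistanceEnergy]
  exact Finset.sum_congr rfl fun e _ => by rw [sq]

theorem sum_mul_outflow_resistance (hΓ : Γ.Connected) (p : V) (g : V → ℝ) :
    ∑ x, g x * Γ.outflow (fun w => Γ.resistance w p) x =
      2 * ∑ x, g x - 2 * g p - ∑ x, g x * Γ.fosterSum x := by
  classical
  simp only [outflow_resistance hΓ, mul_sub, Finset.sum_sub_distrib]
  simp [← Finset.sum_mul, mul_comm]

/-- The energy of `r(·, p)` does not depend on `p`. -/
theorem resistanceEnergy_eq (hΓ : Γ.Connected) (p q : V) :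
    Γ.resistanceEnergy p = Γ.resistanceEnergy q := by
  have h1 := sum_mul_outflow_comm Γ (fun w => Γ.resistance w p) (fun w => Γ.resistance w q)
  have h2 := sum_mul_outflow_resistance hΓ p (fun w => Γ.resistance w q)
  have h3 := sum_mul_outflow_resistance hΓ q (fun w => Γ.resistance w p)
  rw [resistanceEnergy_eq_sum_mul_outflow, resistanceEnergy_eq_sum_mul_outflow,
    sum_mul_outflow_resistance hΓ, sum_mul_outflow_resistance hΓ, resistance_self hΓ,
    resistance_self hΓ]
  linarith [resistance_comm hΓ p q]

theorem sum_resistance_eq (hΓ : Γ.Connected) (p : V) :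
    2 * ∑ x, Γ.resistance x p =
      ∑ e, Γ.edgeResistance e * (Γ.resistance (Γ.src e) p + Γ.resistance (Γ.tgt e) p) /
        Γ.len e + Γ.resistanceEnergy p := by
  rw [resistanceEnergy_eq_sum_mul_outflow, sum_mul_outflow_resistance hΓ, sum_mul_fosterSum,
    resistance_self hΓ]
  ring

end Potential

/-! ### Deleting an edge: parallel law, bridges, and the limits in R. -/

section Edge

variable {V E : Type*} [Fintype V] [Fintype E] {Γ : LengthGraph V E}

open Classical in
theorem outflow_eq_delete_add {V E : Type*} [Fintype E] (Γ : LengthGraph V E) (e : E) (f : V → ℝ) (x : V) :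
    Γ.outflow f x = (Γ.delete e).outflow f x +
      ((if x = Γ.tgt e then 1 else 0) - (if x = Γ.src e then 1 else 0)) *
        ((f (Γ.tgt e) - f (Γ.src e)) / Γ.len e) := by
  rw [outflow, Fintype.sum_eq_add_sum_subtype_ne _ e, add_comm]
  refine congrArg₂ (· + ·) ?_ ?_
  · rw [outflow]
    rfl
  · simp only [eq_comm (a := x)]
    split_ifs <;> ring

open Classical in
theorem voltage_of_delete_connected (hΓ : Γ.Connected) {e : E} (he : (Γ.delete e).Connected)
    (p : V) : Γ.voltage (Γ.src e) p (Γ.tgt e) =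
      Γ.len e / (Γ.len e + Γ.deletedResistance e) *
        (Γ.delete e).voltage (Γ.src e) p (Γ.tgt e) := by
  classical
  have hL := Γ.len_pos e
  have hR : 0 ≤ Γ.deletedResistance e := resistance_nonneg he _ _
  have hu := isVoltage_voltage he (Γ.src e) (Γ.tgt e)
  have ht : (Γ.delete e).voltage (Γ.src e) (Γ.tgt e) (Γ.tgt e) = Γ.deletedResistance e :=
    resistance_comm he _ _
  -- Current divider: c is the share of the unit current that flows through Γ - e, the rest c R / L
  -- passing through e.
  set c := Γ.len e / (Γ.len e + Γ.deletedResistance e) with hc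
  refine IsVoltage.voltage_eq hΓ
    (f := c • fun p => (Γ.delete e).voltage (Γ.src e) p (Γ.tgt e)) ⟨?_, fun x => ?_⟩ p
  · simp [hu.1]
  · rw [outflow_eq_delete_add, outflow_smul, hu.2]
    simp only [Pi.smul_apply, smul_eq_mul, hu.1, ht]
    have : c + c * Γ.deletedResistance e / Γ.len e = 1 := by
      rw [hc]
      field_simp
    linear_combination
      ((if x = Γ.tgt e then 1 else 0) - (if x = Γ.src e then 1 else 0)) * this

open Classical in
theorem edgeResistance_of_delete_connected (hΓ : Γ.Connected) {e : E}
    (he : (Γ.delete e).Connected) : Γ.edgeResistance e =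
      Γ.len e / (Γ.len e + Γ.deletedResistance e) * Γ.deletedResistance e := by
  rw [edgeResistance, resistance_comm hΓ, resistance, voltage_of_delete_connected hΓ he]
  congr 1
  exact resistance_comm he _ _

/-- Follow a walk from p to the source of e until it first uses e; this part avoids e and stops at
an end of e. -/
theorem sameComponent_delete {V E : Type*} {Γ : LengthGraph V E} (hΓ : Γ.Connected) (e : E) (p : V) :
    (Γ.delete e).SameComponent p (Γ.src e) ∨ (Γ.delete e).SameComponent p (Γ.tgt e) := by
  obtain ⟨w⟩ := hΓ.preconnected p (Γ.src e)
  have : ∀ a b, Γ.toSimpleGraph.Walk a b → (Γ.delete e).SameComponent b (Γ.src e) →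
      (Γ.delete e).SameComponent a (Γ.src e) ∨ (Γ.delete e).SameComponent a (Γ.tgt e) := by
    intro a b w hb
    induction w with
    | nil => exact Or.inl hb
    | @cons u w v h _ ih =>
      have h' := ih hb
      rw [toSimpleGraph, SimpleGraph.fromRel_adj] at h
      obtain ⟨hne, ⟨e', rfl, rfl⟩ | ⟨e', rfl, rfl⟩⟩ := h
      · by_cases hee : e' = e
        · subst hee
          exact Or.inl (SimpleGraph.Reachable.refl _)
        · have hadj : (Γ.delete e).SameComponent (Γ.src e') (Γ.tgt e') := by
            refine SimpleGraph.Adj.reachable ?_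
            rw [toSimpleGraph, SimpleGraph.fromRel_adj]
            exact ⟨hne, Or.inl ⟨⟨e', hee⟩, rfl, rfl⟩⟩
          exact h'.imp hadj.trans hadj.trans
      · by_cases hee : e' = e
        · subst hee
          exact Or.inr (SimpleGraph.Reachable.refl _)
        · have hadj : (Γ.delete e).SameComponent (Γ.tgt e') (Γ.src e') := by
            refine SimpleGraph.Adj.reachable ?_
            rw [toSimpleGraph, SimpleGraph.fromRel_adj]
            exact ⟨hne, Or.inr ⟨⟨e', hee⟩, rfl, rfl⟩⟩
          exact h'.imp hadj.trans hadj.trans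
  exact this _ _ w (SimpleGraph.Reachable.refl _)

theorem not_sameComponent_of_bridge {V E : Type*} {Γ : LengthGraph V E} (hΓ : Γ.Connected)
    {e : E} (he : ¬ (Γ.delete e).Connected) :
    ¬ (Γ.delete e).SameComponent (Γ.tgt e) (Γ.src e) := by
  intro h
  have hall : ∀ p, (Γ.delete e).SameComponent p (Γ.src e) := fun p =>
    (sameComponent_delete hΓ e p).elim id fun hp => hp.trans h
  have : Nonempty V := hΓ.nonempty
  exact he (SimpleGraph.Connected.mk fun a b => (hall a).trans (hall b).symm)

theorem sameComponent_src_tgt {V E : Type*} (Γ : LengthGraph V E) (e : E) :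
    Γ.SameComponent (Γ.src e) (Γ.tgt e) := by
  by_cases h : Γ.src e = Γ.tgt e
  · rw [h]
    exact SimpleGraph.Reachable.refl _
  · refine SimpleGraph.Adj.reachable ?_
    rw [toSimpleGraph, SimpleGraph.fromRel_adj]
    exact ⟨h, Or.inl ⟨e, rfl, rfl⟩⟩

-- Across a bridge the potential is constant on each side, so the whole unit current crosses e with
-- drop L.
open Classical in
theorem voltage_of_bridge (hΓ : Γ.Connected) {e : E} (he : ¬ (Γ.delete e).Connected) (p : V) :
    Γ.voltage (Γ.src e) p (Γ.tgt e) =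
      if (Γ.delete e).SameComponent p (Γ.src e) then 0 else Γ.len e := by
  refine IsVoltage.voltage_eq hΓ (f := fun p =>
    if (Γ.delete e).SameComponent p (Γ.src e) then 0 else Γ.len e) ⟨?_, fun x => ?_⟩ p
  · exact if_pos (SimpleGraph.Reachable.refl _)
  · have hs : (Γ.delete e).SameComponent (Γ.src e) (Γ.src e) := SimpleGraph.Reachable.refl _
    rw [outflow_eq_delete_add Γ e, if_pos hs, if_neg (not_sameComponent_of_bridge hΓ he), sub_zero,
      div_self (Γ.len_pos e).ne', mul_one, outflow, Finset.sum_eq_zero, zero_add]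
    intro e' _
    have hiff : (Γ.delete e).SameComponent ((Γ.delete e).src e') (Γ.src e) ↔
        (Γ.delete e).SameComponent ((Γ.delete e).tgt e') (Γ.src e) :=
      ⟨((Γ.delete e).sameComponent_src_tgt e').symm.trans,
        ((Γ.delete e).sameComponent_src_tgt e').trans⟩
    simp [hiff]

theorem edgeResistance_of_bridge (hΓ : Γ.Connected) {e : E} (he : ¬ (Γ.delete e).Connected) :
    Γ.edgeResistance e = Γ.len e := by
  rw [edgeResistance, resistance_comm hΓ, resistance, voltage_of_bridge hΓ he,
    if_neg (not_sameComponent_of_bridge hΓ he)]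

open Classical in
theorem evalR_ratio (hΓ : Γ.Connected) (e : E) :
    Γ.evalR e (fun R => R / (Γ.len e + R)) = Γ.edgeResistance e / Γ.len e := by
  have hL := Γ.len_pos e
  by_cases he : (Γ.delete e).Connected
  · have hR : 0 ≤ Γ.deletedResistance e := resistance_nonneg he _ _
    rw [evalR, if_pos he, edgeResistance_of_delete_connected hΓ he]
    field_simp
  · rw [evalR_ratio_of_bridge Γ e he, edgeResistance_of_bridge hΓ he, div_self hL.ne']

open Classical in
theorem evalR_sq (hΓ : Γ.Connected) (e : E) :
    Γ.evalR e (fun R => Γ.len e * R ^ 2 / (Γ.len e + R) ^ 2) =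
      Γ.edgeResistance e ^ 2 / Γ.len e := by
  have hL := Γ.len_pos e
  by_cases he : (Γ.delete e).Connected
  · have hR : 0 ≤ Γ.deletedResistance e := resistance_nonneg he _ _
    rw [evalR, if_pos he, edgeResistance_of_delete_connected hΓ he]
    field_simp
  · rw [evalR_sq_of_bridge Γ e he, edgeResistance_of_bridge hΓ he]
    field_simp

theorem two_mul_voltage_sub (hΓ : Γ.Connected) (e : E) (p : V) :
    2 * Γ.voltage (Γ.src e) p (Γ.tgt e) - Γ.edgeResistance e =
      Γ.resistance (Γ.src e) p - Γ.resistance (Γ.tgt e) p := by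
  have h := resistance_eq hΓ (Γ.src e) p (Γ.tgt e)
  rw [edgeResistance]
  linarith [resistance_comm hΓ (Γ.src e) p, resistance_comm hΓ (Γ.tgt e) p,
    resistance_comm hΓ (Γ.tgt e) (Γ.src e)]

-- When Γ - e is connected, `voltage_swap` gives R_b = R - R_a, and scaling 2 R_a - R by L / (L + R)
-- gives 2 j_s(p, t) - r_e.
open Classical in
theorem evalR_sub_sq (hΓ : Γ.Connected) (e : E) (p : V) :
    Γ.evalR e (fun R => Γ.len e * (Γ.Ra e p R - Γ.Rb e p R) ^ 2 / (Γ.len e + R) ^ 2) =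
      (Γ.resistance (Γ.src e) p - Γ.resistance (Γ.tgt e) p) ^ 2 / Γ.len e := by
  have hL := Γ.len_pos e
  rw [← two_mul_voltage_sub hΓ]
  by_cases he : (Γ.delete e).Connected
  · have hR : 0 ≤ Γ.deletedResistance e := resistance_nonneg he _ _
    have hb : (Γ.delete e).voltage (Γ.tgt e) p (Γ.src e) =
        Γ.deletedResistance e - (Γ.delete e).voltage (Γ.src e) p (Γ.tgt e) :=
      voltage_swap he _ _ _
    simp only [evalR, if_pos he, Ra, Rb]
    rw [edgeResistance_of_delete_connected hΓ he, voltage_of_delete_connected hΓ he, hb]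
    field_simp
    ring
  · rw [evalR_sub_sq_of_bridge Γ e p he, edgeResistance_of_bridge hΓ he,
      voltage_of_bridge hΓ he]
    split_ifs <;> field_simp <;> ring

theorem y_eq (hΓ : Γ.Connected) (p : V) :
    Γ.y p = 1 / 4 * ∑ e, Γ.edgeResistance e ^ 2 / Γ.len e + 3 / 4 * Γ.resistanceEnergy p := by
  simp only [y, evalR_sq hΓ, evalR_sub_sq hΓ, resistanceEnergy]

end Edge

/-! ### Contracting an edge. -/

section Contract

variable {V E : Type*} [Fintype V] [Fintype E] {Γ : LengthGraph V E}

theorem toContract_src {V E : Type*} (Γ : LengthGraph V E) (e : E) :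
    Γ.toContract e (Γ.src e) = Γ.toContract e (Γ.tgt e) :=
  Quot.sound ⟨rfl, rfl⟩

/-- Sending the target of e to its source descends to the quotient and is the identity on all other
vertices. -/
theorem toContract_inj {V E : Type*} (Γ : LengthGraph V E) (e : E) {p q : V}
    (h : Γ.toContract e p = Γ.toContract e q)
    (hp : Γ.toContract e p ≠ Γ.toContract e (Γ.src e)) : p = q := by
  classical
  have hφ := congrArg (Quot.lift (fun x => if x = Γ.tgt e then Γ.src e else x) (by
    rintro a b ⟨rfl, rfl⟩
    simp)) h
  have hpt : p ≠ Γ.tgt e := by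
    rintro rfl
    exact hp (Γ.toContract_src e).symm
  have hqt : q ≠ Γ.tgt e := by
    rintro rfl
    exact hp (h.trans (Γ.toContract_src e).symm)
  change (if p = Γ.tgt e then Γ.src e else p) = (if q = Γ.tgt e then Γ.src e else q) at hφ
  rwa [if_neg hpt, if_neg hqt] at hφ

theorem sum_contractVertex {V E : Type*} [Fintype V] (Γ : LengthGraph V E) (e : E)
    (f : Γ.ContractVertex e → ℝ)
    (hf : f (Γ.toContract e (Γ.src e)) = 0) : ∑ p, f p = ∑ p, f (Γ.toContract e p) := by
  classical
  rw [← Finset.sum_fiberwise Finset.univ (Γ.toContract e) (fun p => f (Γ.toContract e p))]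
  refine Finset.sum_congr rfl fun a _ => ?_
  obtain ⟨p, rfl⟩ : ∃ p, Γ.toContract e p = a := Quot.mk_surjective a
  by_cases hp : Γ.toContract e p = Γ.toContract e (Γ.src e)
  · rw [hp, hf, Finset.sum_eq_zero]
    intro q hq
    rw [(Finset.mem_filter.1 hq).2, hf]
  · rw [Finset.sum_eq_single p]
    · intro q hq hqp
      exact absurd (Γ.toContract_inj e (Finset.mem_filter.1 hq).2.symm hp).symm hqp
    · simp

-- Compare the energy pairings with the indicator of a: the edge e drops out because pulled-back
-- functions agree at its ends.
open Classical in
theorem outflow_contract (Γ : LengthGraph V E) (e : E) (f : Γ.ContractVertex e → ℝ)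
    (a : Γ.ContractVertex e) :
    (Γ.contract e).outflow f a = ∑ x, (if Γ.toContract e x = a then 1 else 0) *
      Γ.outflow (fun x => f (Γ.toContract e x)) x := by
  have h := sum_mul_outflow (Γ.contract e) f (fun x => if x = a then 1 else 0)
  simp only [ite_mul, one_mul, zero_mul, Finset.sum_ite_eq', Finset.mem_univ, if_true] at h
  rw [sum_mul_outflow, Fintype.sum_eq_add_sum_subtype_ne _ e, toContract_src, sub_self, sub_self,
    mul_zero, zero_div, zero_add, h]
  exact Finset.sum_congr rfl fun e' _ => by congr!

-- Resistances in the contraction are computed in Γ with both ends of e grounded. The product form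
-- also covers r_e = 0, that is, a self-loop.
open Classical in
theorem edgeResistance_mul_resistance_contract (hΓ : Γ.Connected) (e : E) (p : V) :
    Γ.edgeResistance e *
        (Γ.contract e).resistance (Γ.toContract e p) (Γ.toContract e (Γ.src e)) =
      Γ.edgeResistance e * Γ.resistance p (Γ.src e) -
        Γ.voltage (Γ.src e) p (Γ.tgt e) ^ 2 := by
  classical
  by_cases hr : Γ.edgeResistance e = 0
  · have hst : Γ.voltage (Γ.src e) p (Γ.tgt e) = 0 := by
      rw [← eq_of_resistance_eq_zero hΓ hr, voltage_comm hΓ, voltage_self_left hΓ]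
    rw [hr, hst]
    ring
  have hr' : Γ.voltage (Γ.src e) (Γ.tgt e) (Γ.tgt e) = Γ.edgeResistance e :=
    resistance_comm hΓ _ _
  -- This multiple of the flow from t to s makes h vanish at t as well as at s, so h descends to the
  -- contraction, where the added source and sink merge and cancel.
  set c := Γ.voltage (Γ.src e) (Γ.tgt e) p / Γ.edgeResistance e with hc
  set h : V → ℝ := (fun w => Γ.voltage (Γ.src e) w p) -
    c • fun w => Γ.voltage (Γ.src e) w (Γ.tgt e) with hh
  have hs : h (Γ.src e) = 0 := by simp [hh, voltage_self_left hΓ]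
  have ht : h (Γ.tgt e) = 0 := by
    simp only [hh, Pi.sub_apply, Pi.smul_apply, smul_eq_mul, hr', hc]
    field_simp
    ring
  obtain ⟨k, hk⟩ : ∃ k : Γ.ContractVertex e → ℝ, ∀ x, k (Γ.toContract e x) = h x :=
    ⟨Quot.lift h (by rintro a b ⟨rfl, rfl⟩; rw [hs, ht]), fun _ => rfl⟩
  have hV : (Γ.contract e).IsVoltage (Γ.toContract e (Γ.src e)) (Γ.toContract e p) k := by
    refine ⟨(hk _).trans hs, fun a => ?_⟩
    rw [outflow_contract, funext hk]
    simp only [hh, outflow_sub, outflow_smul, outflow_voltage hΓ, mul_sub, mul_left_comm _ c,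
      Finset.sum_sub_distrib, ← Finset.mul_sum]
    simp [toContract_src, eq_comm (a := a)]
  have hres : (Γ.contract e).resistance (Γ.toContract e p) (Γ.toContract e (Γ.src e)) = h p :=
    (hV.voltage_eq (Γ.contract_connected e hΓ) _).trans (hk p)
  rw [hres, hh]
  simp only [Pi.sub_apply, Pi.smul_apply, smul_eq_mul, hc, resistance]
  rw [voltage_comm hΓ _ (Γ.tgt e) p]
  field_simp

open Classical in
theorem evalR_ratio_mul_contractResistanceSum (hΓ : Γ.Connected) (e : E) :
    Γ.evalR e (fun R => R / (Γ.len e + R)) * Γ.contractResistanceSum e =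
      ∑ p, (2 * (Γ.edgeResistance e *
          (Γ.resistance (Γ.src e) p + Γ.resistance (Γ.tgt e) p) / Γ.len e) -
        (Γ.resistance (Γ.src e) p - Γ.resistance (Γ.tgt e) p) ^ 2 / Γ.len e -
        Γ.edgeResistance e ^ 2 / Γ.len e) / 4 := by
  rw [evalR_ratio hΓ, contractResistanceSum,
    sum_contractVertex Γ e
      (fun a => (Γ.contract e).resistance a (Γ.toContract e (Γ.src e)))
      (resistance_self (Γ.contract_connected e hΓ) _),
    div_mul_eq_mul_div, Finset.mul_sum, Finset.sum_div]
  refine Finset.sum_congr rfl fun p _ => ?_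
  rw [edgeResistance_mul_resistance_contract hΓ]
  -- With this value, r_e a - j_s(p, t)² becomes symmetric in the two ends of e.
  have hv : Γ.voltage (Γ.src e) p (Γ.tgt e) =
      (Γ.resistance (Γ.src e) p - Γ.resistance (Γ.tgt e) p + Γ.edgeResistance e) / 2 := by
    linarith [two_mul_voltage_sub hΓ e p]
  rw [hv, resistance_comm hΓ p]
  ring

end Contract

end LengthGraph

/-! ### Summation over the base vertex. -/

theorem mainTheorem5 {V E : Type*} [Fintype V] [Fintype E] (Γ : LengthGraph V E)
    (hΓ : Γ.Connected) (p₀ : V) :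
    2 * Γ.kirchhoffIndex = (Fintype.card V : ℝ) * Γ.y p₀ +
      ∑ e : E, Γ.evalR e (fun R => R / (Γ.len e + R)) * Γ.contractResistanceSum e := by
  -- Independence of the base vertex spreads v · y(Γ) over all p, so that the identity can be
  -- checked for each p separately.
  have hy : (Fintype.card V : ℝ) * Γ.y p₀ = ∑ p, Γ.y p := by
    rw [Finset.sum_congr rfl fun p _ => show Γ.y p = Γ.y p₀ by
      rw [LengthGraph.y_eq hΓ, LengthGraph.y_eq hΓ, LengthGraph.resistanceEnergy_eq hΓ p p₀]]
    simp
  rw [hy, Finset.sum_congr rfl fun e _ => LengthGraph.evalR_ratio_mul_contractResistanceSum hΓ e,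
    Finset.sum_comm, ← Finset.sum_add_distrib, LengthGraph.kirchhoffIndex, ← mul_assoc,
    mul_one_div_cancel two_ne_zero, one_mul, Finset.sum_comm]
  refine Finset.sum_congr rfl fun p _ => ?_
  have h := LengthGraph.sum_resistance_eq hΓ p
  rw [LengthGraph.y_eq hΓ, ← Finset.sum_div, Finset.sum_sub_distrib, Finset.sum_sub_distrib,
    ← Finset.mul_sum, ← LengthGraph.resistanceEnergy]
  linarith
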